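/- Work in an arbitrary countably saturated nonstandard universe: there is a map $a\mapsto{}^*a$ from the standard objects over $\mathbb N$ (numbers, pairs, sets of such objects, and so on through all finite types) to internal objects which satisfies the transfer principle, and every countable family of internal sets with the finite intersection property has nonempty intersection. A set of internal objects is called \emph{countably determined} (CD) if it has the form $$X=\bigcup_{b\in B}\Bigl(\bigcap_{m\in b}X_m\cap\bigcap_{m\notin b}\bigl(\textstyle\bigcup_nX_n\setminus X_m\bigr)\Bigr)$$ for some sequence $(X_m)_{m\in\mathbb N}$ of internal sets and some $B\subseteq\mathcal P(\mathbb N)$; a map is CD if its graph is CD. For equivalence relations $\mathsf E$ on $X$ and $\mathsf F$ on $Y$, $\mathsf E$ is \emph{CD-reducible} to $\mathsf F$ if there is a CD map $\vartheta:X\to Y$ with $x\,\mathsf E\,x'\iff\vartheta(x)\,\mathsf F\,\vartheta(x')$ for all $x,x'\in X$. A \emph{cut} is an initial segment $U\subseteq{}^*\mathbb N$; it is \emph{additive} if $x+y\in U$ whenever $x,y\in U$, and \emph{countably cofinal} if $U=\bigcup_{n\in\mathbb N}[0,a_n)$ for some strictly increasing sequence $(a_n)_{n\in\mathbb N}$ in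 ${}^*\mathbb N$. For an additive countably cofinal cut $U$, let $x\,\mathsf E_U\,y$ iff $|x-y|\in U$, for $x,y\in{}^*\mathbb N$. For a hyperfinite (internal) set $D\subseteq{}^*\mathbb N$, let $\mathsf{FD}_D$ be the equivalence relation on the set of all internal subsets of $D$ given by $u\,\mathsf{FD}_D\,v$ iff the symmetric difference $u\,\triangle\,v$ is finite. \textbf{Theorem.} If $D\subseteq{}^*\mathbb N$ is an infinite hyperfinite set and $U$ is an additive countably cofinal cut in ${}^*\mathbb N$, then $\mathsf{FD}_D$ is not CD-reducible to $\mathsf E_U$. -/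

import Mathlib

universe u

namespace Nonstandard

/-! ## Typed superstructure over the natural numbers and its formulas -/

/-- The types of the objects of the superstructure over the natural numbers: natural numbers,
pairs, and sets of objects of a given type. -/
inductive Ty : Type
  | nat : Ty
  | prod : Ty → Ty → Ty
  | set : Ty → Ty

/-- The standard objects of each type. -/
def Ty.Std : Ty → Type
  | .nat => ℕ
  | .prod σ τ => Ty.Std σ × Ty.Std τ
  | .set τ => Set (Ty.Std τ)

/-- A structure for the language of membership and pairing over the types. -/
structure TypedStructure where
  /-- the objects of each type -/
  Obj : Ty → Type u
  /-- membership -/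
  mem : ∀ {τ : Ty}, Obj τ → Obj (.set τ) → Prop
  /-- pairing -/
  pair : ∀ {σ τ : Ty}, Obj σ → Obj τ → Obj (.prod σ τ)

/-- The full standard structure, with true membership and true pairs. -/
def standard : TypedStructure.{0} where
  Obj := Ty.Std
  mem := fun {τ} (x : Ty.Std τ) (A : Set (Ty.Std τ)) => x ∈ A
  pair := fun x y => (x, y)

/-- De Bruijn variables of type `τ` in a context listing the types of the free variables. -/
inductive Var : List Ty → Ty → Type
  | zero {Γ : List Ty} {τ : Ty} : Var (τ :: Γ) τ
  | succ {Γ : List Ty} {σ τ : Ty} : Var Γ τ → Var (σ :: Γ) τ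

/-- Terms: variables and pairs. -/
inductive Term (Γ : List Ty) : Ty → Type
  | var {τ : Ty} : Var Γ τ → Term Γ τ
  | pair {σ τ : Ty} : Term Γ σ → Term Γ τ → Term Γ (.prod σ τ)

/-- Formulas, with quantifiers over the objects of any given type. The remaining connectives and
the existential quantifier are definable from the listed ones. -/
inductive Formula : List Ty → Type
  | eq {Γ : List Ty} {τ : Ty} : Term Γ τ → Term Γ τ → Formula Γ
  | mem {Γ : List Ty} {τ : Ty} : Term Γ τ → Term Γ (.set τ) → Formula Γ
  | not {Γ : List Ty} : Formula Γ → Formula Γ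
  | and {Γ : List Ty} : Formula Γ → Formula Γ → Formula Γ
  | all {Γ : List Ty} (τ : Ty) : Formula (τ :: Γ) → Formula Γ

/-- An assignment of values to the variables of a context. -/
def Env (S : TypedStructure.{u}) (Γ : List Ty) : Type u :=
  ∀ τ : Ty, Var Γ τ → S.Obj τ

/-- Extend an assignment by a value for the new innermost variable. -/
def Env.cons {S : TypedStructure.{u}} {Γ : List Ty} {σ : Ty} (a : S.Obj σ) (ρ : Env S Γ) :
    Env S (σ :: Γ)
  | _, .zero => a
  | _, .succ v => ρ _ v

/-- The value of a term. -/
def Term.eval {S : TypedStructure.{u}} {Γ : List Ty} (ρ : Env S Γ) :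
    {τ : Ty} → Term Γ τ → S.Obj τ
  | _, .var v => ρ _ v
  | _, .pair s t => S.pair (s.eval ρ) (t.eval ρ)

/-- Truth of a formula in a structure under an assignment. -/
def Formula.Holds {S : TypedStructure.{u}} : {Γ : List Ty} → Formula Γ → Env S Γ → Prop
  | _, .eq s t, ρ => s.eval ρ = t.eval ρ
  | _, .mem s t, ρ => S.mem (s.eval ρ) (t.eval ρ)
  | _, .not φ, ρ => ¬ φ.Holds ρ
  | _, .and φ ψ, ρ => φ.Holds ρ ∧ ψ.Holds ρ
  | _, .all τ φ, ρ => ∀ a : S.Obj τ, φ.Holds (Env.cons a ρ)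

/-! ## Countably saturated nonstandard universes -/

/-- A countably saturated nonstandard universe: its objects (the internal objects), together with
a map `star` of the standard objects into it that satisfies the transfer principle, and such that
any countable family of internal sets with the finite intersection property has a common element.
(Saturation makes the extension of the natural numbers proper.) -/
structure Universe extends TypedStructure.{u} where
  /-- the nonstandard copy of a standard object -/
  star : ∀ {τ : Ty}, Ty.Std τ → Obj τ
  /-- the transfer principle -/
  transfer : ∀ {Γ : List Ty} (φ : Formula Γ) (ρ : Env standard Γ),
    φ.Holds ρ ↔ φ.Holds (S := toTypedStructure) (fun τ v => star (ρ τ v))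
  /-- countable saturation -/
  saturation : ∀ {τ : Ty} (A : ℕ → Obj (.set τ)),
    (∀ n : ℕ, ∃ x : Obj τ, ∀ m < n, mem x (A m)) → ∃ x : Obj τ, ∀ m : ℕ, mem x (A m)

namespace Universe

variable (M : Universe.{u})

/-- The hypernatural numbers. -/
abbrev HyperNat : Type u := M.Obj .nat

/-- The set of elements of an internal set. -/
def elems {τ : Ty} (A : M.Obj (.set τ)) : Set (M.Obj τ) := {x | M.mem x A}

/-- The order on the hypernatural numbers. -/
def Lt (x y : M.HyperNat) : Prop :=
  M.mem (M.pair x y) (M.star (τ := .set (.prod .nat .nat)) {p : ℕ × ℕ | p.1 < p.2})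

/-- `z = x + y` in the hypernatural numbers. -/
def IsSum (x y z : M.HyperNat) : Prop :=
  M.mem (M.pair (M.pair x y) z)
    (M.star (τ := .set (.prod (.prod .nat .nat) .nat)) {p : (ℕ × ℕ) × ℕ | p.2 = p.1.1 + p.1.2})

/-- `d = |x - y|` in the hypernatural numbers. -/
def IsAbsDiff (x y d : M.HyperNat) : Prop :=
  M.mem (M.pair (M.pair x y) d)
    (M.star (τ := .set (.prod (.prod .nat .nat) .nat))
      {p : (ℕ × ℕ) × ℕ | (p.2 : ℤ) = |(p.1.1 : ℤ) - (p.1.2 : ℤ)|})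

/-- An internal set of hypernatural numbers is hyperfinite if it belongs to the nonstandard copy
of the family of all finite sets of natural numbers. -/
def Hyperfinite (D : M.Obj (.set .nat)) : Prop :=
  M.mem D (M.star (τ := .set (.set .nat)) {A : Set ℕ | A.Finite})

/-- The (internal) power set: all internal subsets of `D`. -/
def internalSubsets {τ : Ty} (D : M.Obj (.set τ)) : Set (M.Obj (.set τ)) :=
  {v | M.elems v ⊆ M.elems D}

/-! ### Cuts -/

/-- A cut: an initial segment of the hypernatural numbers. -/
def IsCut (U : Set M.HyperNat) : Prop := ∀ x y : M.HyperNat, M.Lt x y → y ∈ U → x ∈ U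

/-- Closure under addition. -/
def IsAdditive (U : Set M.HyperNat) : Prop :=
  ∀ x ∈ U, ∀ y ∈ U, ∀ z : M.HyperNat, M.IsSum x y z → z ∈ U

/-- `U` is the union of the intervals `[0, a n)` for a strictly increasing sequence `a`. -/
def IsCountablyCofinal (U : Set M.HyperNat) : Prop :=
  ∃ a : ℕ → M.HyperNat, (∀ m n : ℕ, m < n → M.Lt (a m) (a n)) ∧ U = ⋃ n : ℕ, {x | M.Lt x (a n)}

/-! ### Countably determined sets and reductions -/

/-- Countably determined sets. -/
def IsCD {τ : Ty} (X : Set (M.Obj τ)) : Prop :=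
  ∃ (A : ℕ → M.Obj (.set τ)) (B : Set (Set ℕ)),
    X = ⋃ b ∈ B, ((⋂ m ∈ b, M.elems (A m)) ∩ ⋂ m ∈ bᶜ, ((⋃ n, M.elems (A n)) \ M.elems (A m)))

/-- The relation `E` on `X` is CD-reducible to the relation `F` on `Y`: there is a map from `X`
to `Y` with countably determined graph that is a reduction. -/
def CDReducible {σ τ : Ty} (X : Set (M.Obj σ)) (E : M.Obj σ → M.Obj σ → Prop)
    (Y : Set (M.Obj τ)) (F : M.Obj τ → M.Obj τ → Prop) : Prop :=
  ∃ θ : X → Y, M.IsCD {p : M.Obj (.prod σ τ) | ∃ x : X, p = M.pair (x : M.Obj σ) (θ x : M.Obj τ)} ∧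
    ∀ x x' : X, E x x' ↔ F (θ x) (θ x')

/-! ### The equivalence relations -/

/-- The finite difference relation on internal sets of hypernatural numbers: the symmetric
difference is (truly) finite. -/
def FD (v w : M.Obj (.set .nat)) : Prop := (symmDiff (M.elems v) (M.elems w)).Finite

/-- The monadic relation of `U`: `|x - y|` belongs to `U`. -/
def monadic (U : Set M.HyperNat) (x y : M.HyperNat) : Prop := ∃ d ∈ U, M.IsAbsDiff x y d

end Universe

end Nonstandard

/-! Suppose a CD map `θ` reduced `FD` to the monadic relation of `U`. The graph of `θ` need not be
internal. Whether a pair lies in it depends only on the pair's type, meaning the set of indices `m`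
with the pair in `A m`. Ramsey's theorem and saturation give an internal family `F` of subsets of
`D` over which the same finite patterns are realised, whichever member is taken
(`exists_homogeneous_family`). By saturation the pairs `(u, θ u)` with `u` in `F` then all have one
common type, so over `F` the graph of `θ` is the intersection of a decreasing sequence of internal
relations `G n` (`exists_family_graph`).

Both equivalence relations are increasing countable unions of internal relations: `FD` of `CloseLE
n`, the monadic relation of `AbsLt` with bound `a n`. Saturation (`exists_pair_of_antitone`)
therefore makes each direction of the reduction uniform. For some `n`, members of `F` differing in
at most 2 points have `G n`-values less than `a n` apart. For some `K ≥ n`, members with `G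
K`-values less than `a n` apart differ in at most `K` points.

Finite combinatorics refutes this. Take a function on the `k`-element subsets of a large finite set
that moves by less than `a` at each exchange. It varies by at most `k * a` in either direction, so
among `2 * k + 2` disjoint `k`-sets two have values less than `a` apart
(`exists_disjoint_abs_sub_lt`). With `k = K + 1` these two sets differ in more than `K` points. The
property `spread K` records this conclusion in a form that transfers, and `F` is built to have it
for every standard `K`. -/

namespace Nonstandard

/-! ## Derived connectives, renaming and closure of formulas -/

namespace Formula

/-- Implication. -/
def imp {Γ : List Ty} (φ ψ : Formula Γ) : Formula Γ := .not (.and φ (.not ψ))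

/-- Equivalence. -/
def iff {Γ : List Ty} (φ ψ : Formula Γ) : Formula Γ := .and (imp φ ψ) (imp ψ φ)

/-- Disjunction. -/
def or {Γ : List Ty} (φ ψ : Formula Γ) : Formula Γ := .not (.and (.not φ) (.not ψ))

/-- Existential quantification. -/
def ex {Γ : List Ty} (τ : Ty) (φ : Formula (τ :: Γ)) : Formula Γ := .not (.all τ (.not φ))

variable {S : TypedStructure.{u}} {Γ Δ : List Ty}

@[simp] theorem holds_imp (φ ψ : Formula Γ) (ρ : Env S Γ) :
    (imp φ ψ).Holds ρ ↔ (φ.Holds ρ → ψ.Holds ρ) := by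
  simp [imp, Holds]

@[simp] theorem holds_iff (φ ψ : Formula Γ) (ρ : Env S Γ) :
    (iff φ ψ).Holds ρ ↔ (φ.Holds ρ ↔ ψ.Holds ρ) := by
  simp only [iff, Holds, holds_imp]; tauto

@[simp] theorem holds_or (φ ψ : Formula Γ) (ρ : Env S Γ) :
    (or φ ψ).Holds ρ ↔ (φ.Holds ρ ∨ ψ.Holds ρ) := by
  simp only [or, Holds]; tauto

@[simp] theorem holds_ex (τ : Ty) (φ : Formula (τ :: Γ)) (ρ : Env S Γ) :
    (ex τ φ).Holds ρ ↔ ∃ a : S.Obj τ, φ.Holds (Env.cons a ρ) := by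
  simp [ex, Holds]

end Formula

/-- Lift a renaming of variables under a binder. -/
def Var.liftRen {Γ Δ : List Ty} {σ : Ty} (r : ∀ τ, Var Γ τ → Var Δ τ) :
    ∀ τ, Var (σ :: Γ) τ → Var (σ :: Δ) τ
  | _, .zero => .zero
  | _, .succ v => .succ (r _ v)

/-- Rename the variables of a term. -/
def Term.ren {Γ Δ : List Ty} (r : ∀ τ, Var Γ τ → Var Δ τ) : {τ : Ty} → Term Γ τ → Term Δ τ
  | _, .var v => .var (r _ v)
  | _, .pair s t => .pair (s.ren r) (t.ren r)

/-- Rename the free variables of a formula. -/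
def Formula.ren : {Γ Δ : List Ty} → (∀ τ, Var Γ τ → Var Δ τ) → Formula Γ → Formula Δ
  | _, _, r, .eq s t => .eq (s.ren r) (t.ren r)
  | _, _, r, .mem s t => .mem (s.ren r) (t.ren r)
  | _, _, r, .not φ => .not (φ.ren r)
  | _, _, r, .and φ ψ => .and (φ.ren r) (ψ.ren r)
  | _, _, r, .all τ φ => .all τ (φ.ren (Var.liftRen r))

theorem Term.eval_ren {S : TypedStructure.{u}} {Γ Δ : List Ty} (r : ∀ τ, Var Γ τ → Var Δ τ)
    (ρ : Env S Δ) {τ : Ty} (t : Term Γ τ) :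
    (t.ren r).eval ρ = t.eval (fun τ v => ρ τ (r τ v)) := by
  induction t with
  | var v => rfl
  | pair s t hs ht => simp only [Term.ren, Term.eval, hs, ht]

theorem Env.cons_liftRen {S : TypedStructure.{u}} {Γ Δ : List Ty} {σ : Ty}
    (r : ∀ τ, Var Γ τ → Var Δ τ) (ρ : Env S Δ) (a : S.Obj σ) :
    (fun τ v => Env.cons a ρ τ (Var.liftRen r τ v)) = Env.cons a (fun τ v => ρ τ (r τ v)) := by
  funext τ v
  cases v <;> rfl

theorem Formula.holds_ren {S : TypedStructure.{u}} {Γ Δ : List Ty} (r : ∀ τ, Var Γ τ → Var Δ τ)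
    (φ : Formula Γ) (ρ : Env S Δ) :
    (φ.ren r).Holds ρ ↔ φ.Holds (fun τ v => ρ τ (r τ v)) := by
  induction φ generalizing Δ with
  | eq s t => simp only [Formula.ren, Formula.Holds, Term.eval_ren]
  | mem s t => simp only [Formula.ren, Formula.Holds, Term.eval_ren]
  | not φ ih => simp only [Formula.ren, Formula.Holds, ih]
  | and φ ψ ih ih' => simp only [Formula.ren, Formula.Holds, ih, ih']
  | all τ φ ih => simp only [Formula.ren, Formula.Holds, ih, Env.cons_liftRen]

/-- The universal closure of a formula. -/
def Formula.close : (Γ : List Ty) → Formula Γ → Formula []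
  | [], φ => φ
  | τ :: Γ, φ => Formula.close Γ (.all τ φ)

/-- The empty assignment. -/
def Env.nil {S : TypedStructure.{u}} : Env S [] := fun _ v => nomatch v

@[simp] theorem Env.cons_zero {S : TypedStructure.{u}} {Γ : List Ty} {σ : Ty} (a : S.Obj σ)
    (ρ : Env S Γ) : Env.cons a ρ σ .zero = a := rfl

@[simp] theorem Env.cons_succ {S : TypedStructure.{u}} {Γ : List Ty} {σ τ : Ty} (a : S.Obj σ)
    (ρ : Env S Γ) (v : Var Γ τ) : Env.cons a ρ τ (.succ v) = ρ τ v := rfl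

theorem Env.eq_nil {S : TypedStructure.{u}} (ρ : Env S []) : ρ = Env.nil := by
  funext τ v
  cases v

theorem Env.eq_cons {S : TypedStructure.{u}} {Γ : List Ty} {σ : Ty} (ρ : Env S (σ :: Γ)) :
    ρ = Env.cons (ρ σ .zero) (fun τ v => ρ τ (.succ v)) := by
  funext τ v
  cases v <;> rfl

theorem Formula.holds_close {S : TypedStructure.{u}} (Γ : List Ty) (φ : Formula Γ)
    (ρ₀ : Env S []) : (Formula.close Γ φ).Holds ρ₀ ↔ ∀ ρ : Env S Γ, φ.Holds ρ := by
  induction Γ with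
  | nil => exact ⟨fun h ρ => by rw [Env.eq_nil ρ, ← Env.eq_nil ρ₀]; exact h, fun h => h _⟩
  | cons τ Γ ih =>
    rw [Formula.close, ih]
    refine ⟨fun h ρ => ?_, fun h ρ a => h _⟩
    rw [Env.eq_cons ρ]
    exact h _ _

namespace Universe

variable (M : Universe.{u})

/-! ## Consequences of transfer -/

/-- `transfer` speaks only of standard parameters. Closing the formula universally removes all
parameters, so a standard validity transfers to arbitrary internal ones. -/
theorem holds_of_valid {Γ : List Ty} (φ : Formula Γ) (h : ∀ ρ : Env standard Γ, φ.Holds ρ)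
    (ρ : Env M.toTypedStructure Γ) : φ.Holds ρ := by
  exact (Formula.holds_close Γ φ _).1
    ((M.transfer (Formula.close Γ φ) Env.nil).1 ((Formula.holds_close Γ φ _).2 h)) ρ

end Universe

/-- The formula asserting that the set defined by `φ` exists. -/
def Formula.compr {Γ : List Ty} {τ : Ty} (φ : Formula (τ :: Γ)) : Formula Γ :=
  (Formula.all τ (Formula.iff (Formula.mem (.var .zero) (.var (.succ .zero)))
    -- The renaming skips the newly bound set variable, so `φ` cannot refer to the set being
    -- defined.
    (φ.ren (Var.liftRen (fun _ v => .succ v))))).ex (.set τ)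

theorem Formula.holds_compr {S : TypedStructure.{u}} {Γ : List Ty} {τ : Ty}
    (φ : Formula (τ :: Γ)) (ρ : Env S Γ) :
    φ.compr.Holds ρ ↔ ∃ A : S.Obj (.set τ), ∀ x, S.mem x A ↔ φ.Holds (Env.cons x ρ) := by
  simp only [compr, holds_ex, Holds, holds_iff, holds_ren, Env.cons_liftRen, Term.eval,
    Env.cons_zero, Env.cons_succ]

/-- Internal comprehension: a set defined by a formula with internal parameters is internal. -/
theorem Universe.comprehension (M : Universe.{u}) {Γ : List Ty} {τ : Ty} (φ : Formula (τ :: Γ))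
    (ρ : Env M.toTypedStructure Γ) :
    ∃ A : M.Obj (.set τ), ∀ x, M.mem x A ↔ φ.Holds (Env.cons x ρ) :=
  (φ.holds_compr ρ).1 (M.holds_of_valid _
    (fun ρ' => (φ.holds_compr ρ').2
      ⟨{x | φ.Holds (S := standard) (Env.cons x ρ')}, fun _ => Iff.rfl⟩) ρ)

/-! ## Finite combinatorics -/

/-- The finite Ramsey theorem for two-colourings of the `k`-element subsets. -/
theorem exists_ramsey (k p q : ℕ) : ∃ N : ℕ, ∀ (D : Finset ℕ) (c : Set (Finset ℕ)), N ≤ D.card →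
    (∃ E ⊆ D, p ≤ E.card ∧ ∀ u ⊆ E, u.card = k → u ∈ c) ∨
    (∃ E ⊆ D, q ≤ E.card ∧ ∀ u ⊆ E, u.card = k → u ∉ c) := by
  induction k generalizing p q with
  | zero =>
    refine ⟨max p q, fun D c hD => ?_⟩
    by_cases h : ∅ ∈ c
    · exact .inl ⟨D, subset_rfl, by omega, fun u _ hu => by rwa [Finset.card_eq_zero.1 hu]⟩
    · exact .inr ⟨D, subset_rfl, by omega, fun u _ hu => by rwa [Finset.card_eq_zero.1 hu]⟩
  | succ k ihk =>
    have hempty : ∀ u ⊆ (∅ : Finset ℕ), u.card ≠ k + 1 := by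
      intro u hu h
      rw [Finset.subset_empty.1 hu] at h
      simp at h
    induction p generalizing q with
    | zero => exact ⟨0, fun D c _ => .inl ⟨∅, by simp, by simp, fun u hu h => (hempty u hu h).elim⟩⟩
    | succ p ihp =>
      induction q with
      | zero =>
        exact ⟨0, fun D c _ => .inr ⟨∅, by simp, by simp, fun u hu h => (hempty u hu h).elim⟩⟩
      | succ q ihq =>
        obtain ⟨N₁, h₁⟩ := ihp (q + 1)
        obtain ⟨N₂, h₂⟩ := ihq
        -- Set aside one point `x` and colour the `k`-subsets of the rest by the colour they get
        -- once `x` is added. A homogeneous set for this colouring must be large enough for either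
        -- inductive hypothesis.
        obtain ⟨N, hN⟩ := ihk N₁ N₂
        refine ⟨N + 1, fun D c hD => ?_⟩
        obtain ⟨x, hx⟩ : D.Nonempty := Finset.card_pos.1 (by omega)
        have hcard : N ≤ (D.erase x).card := by rw [Finset.card_erase_of_mem hx]; omega
        -- Stated for an arbitrary colour class so that it serves for both `c` and `cᶜ`.
        have extend : ∀ (c' : Set (Finset ℕ)) (r : ℕ) (E E' : Finset ℕ), E ⊆ D.erase x →
            (∀ u ⊆ E, u.card = k → insert x u ∈ c') → E' ⊆ E → r ≤ E'.card →
            (∀ u ⊆ E', u.card = k + 1 → u ∈ c') →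
            ∃ E ⊆ D, r + 1 ≤ E.card ∧ ∀ u ⊆ E, u.card = k + 1 → u ∈ c' := by
          intro c' r E E' hE hEc hE' hr hc'
          have hxE' : x ∉ E' := fun h => Finset.notMem_erase x D (hE (hE' h))
          refine ⟨insert x E', Finset.insert_subset hx
            ((hE'.trans hE).trans (Finset.erase_subset _ _)), ?_, fun u hu huc => ?_⟩
          · rw [Finset.card_insert_of_notMem hxE']; omega
          · by_cases hxu : x ∈ u
            · rw [← Finset.insert_erase hxu]
              exact hEc _ ((Finset.subset_insert_iff.1 hu).trans hE')
                (by rw [Finset.card_erase_of_mem hxu]; omega)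
            · exact hc' u ((Finset.subset_insert_iff_of_notMem hxu).1 hu) huc
        rcases hN (D.erase x) {u | insert x u ∈ c} hcard with ⟨E, hE, hEN, hEc⟩ | ⟨E, hE, hEN, hEc⟩
        · rcases h₁ E c hEN with ⟨E', hE', hr, hc⟩ | ⟨E', hE', hr, hc⟩
          · exact .inl (extend c p E E' hE hEc hE' hr hc)
          · exact .inr ⟨E', (hE'.trans hE).trans (Finset.erase_subset _ _), hr, hc⟩
        · rcases h₂ E c hEN with ⟨E', hE', hr, hc⟩ | ⟨E', hE', hr, hc⟩
          · exact .inl ⟨E', (hE'.trans hE).trans (Finset.erase_subset _ _), hr, hc⟩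
          · exact .inr (extend cᶜ q E E' hE hEc hE' hr hc)

/-- Two sets of the same size are joined by a path of single exchanges. -/
theorem abs_sub_le_card_sdiff_mul {f : Finset ℕ → ℤ} {E : Finset ℕ} {k : ℕ} {a : ℤ}
    (hf : ∀ u ⊆ E, ∀ v ⊆ E, u.card = k → v.card = k → (symmDiff u v).card ≤ 2 →
      |f u - f v| < a)
    (u v : Finset ℕ) (hu : u ⊆ E) (hv : v ⊆ E) (huk : u.card = k) (hvk : v.card = k) :
    |f u - f v| ≤ (u \ v).card * a := by
  induction hn : (u \ v).card generalizing u with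
  | zero =>
    have huv : u = v := Finset.eq_of_subset_of_card_le
      (Finset.sdiff_eq_empty_iff_subset.1 (Finset.card_eq_zero.1 hn)) (by omega)
    simp [huv]
  | succ n ih =>
    have hn' : (v \ u).card = n + 1 := by
      rw [← hn, Finset.card_sdiff_comm (hvk.trans huk.symm)]
    obtain ⟨x, hx⟩ : (u \ v).Nonempty := Finset.card_pos.1 (by omega)
    obtain ⟨y, hy⟩ : (v \ u).Nonempty := Finset.card_pos.1 (by omega)
    rw [Finset.mem_sdiff] at hx hy
    have hyx : y ∉ u.erase x := fun h => hy.2 (Finset.mem_of_mem_erase h)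
    have hw : insert y (u.erase x) ⊆ E :=
      Finset.insert_subset (hv hy.1) ((Finset.erase_subset _ _).trans hu)
    have hwk : (insert y (u.erase x)).card = k := by
      rw [Finset.card_insert_of_notMem hyx, Finset.card_erase_of_mem hx.1, huk]
      have : 0 < u.card := Finset.card_pos.2 ⟨x, hx.1⟩
      omega
    have hwn : (insert y (u.erase x) \ v).card = n := by
      have : insert y (u.erase x) \ v = (u \ v).erase x := by
        ext z
        simp only [Finset.mem_sdiff, Finset.mem_insert, Finset.mem_erase]
        constructor
        · rintro ⟨rfl | h, hz⟩
          · exact absurd hy.1 hz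
          · exact ⟨h.1, h.2, hz⟩
        · rintro ⟨h1, h2, h3⟩
          exact ⟨.inr ⟨h1, h2⟩, h3⟩
      rw [this, Finset.card_erase_of_mem (Finset.mem_sdiff.2 hx), hn]
      rfl
    have hclose : (symmDiff u (insert y (u.erase x))).card ≤ 2 := by
      refine (Finset.card_le_card (t := {x, y}) fun z hz => ?_).trans Finset.card_le_two
      simp only [Finset.mem_symmDiff, Finset.mem_insert, Finset.mem_erase,
        Finset.mem_singleton] at hz ⊢
      tauto
    have h1 := hf u hu _ hw huk hwk hclose
    have h2 := ih _ hw hwk hwn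
    have h3 := abs_sub_le (f u) (f (insert y (u.erase x))) (f v)
    push_cast
    linarith

/-- A large finite set contains many disjoint `k`-element subsets. -/
theorem exists_pairwise_disjoint (k m : ℕ) (E : Finset ℕ) (hE : m * k ≤ E.card) :
    ∃ W : Fin m → Finset ℕ, (∀ i, W i ⊆ E ∧ (W i).card = k) ∧
      ∀ i j, i ≠ j → Disjoint (W i) (W j) := by
  induction m generalizing E with
  | zero => exact ⟨fun i => i.elim0, fun i => i.elim0, fun i => i.elim0⟩
  | succ m ih =>
    rw [Nat.succ_mul] at hE
    obtain ⟨A, hA, hAk⟩ := Finset.exists_subset_card_eq (show k ≤ E.card by omega)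
    obtain ⟨W, hW, hd⟩ := ih (E \ A) (by rw [Finset.card_sdiff_of_subset hA]; omega)
    have hWA : ∀ i, Disjoint A (W i) := fun i =>
      Finset.disjoint_of_subset_right (hW i).1 Finset.disjoint_sdiff
    refine ⟨Fin.cons A W, fun i => ?_, fun i j => ?_⟩
    · refine Fin.cases ⟨hA, hAk⟩ (fun i => ?_) i
      exact ⟨(hW i).1.trans Finset.sdiff_subset, (hW i).2⟩
    · refine Fin.cases (fun h => ?_) (fun i h => ?_) i
      · revert h
        refine Fin.cases (fun h => (h rfl).elim) (fun j _ => ?_) j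
        simpa using hWA j
      · revert h
        refine Fin.cases (fun _ => ?_) (fun j h => ?_) j
        · simpa using (hWA i).symm
        · simpa using hd i j (fun e => h (by rw [e]))

/-- A map on the `k`-element subsets of a large set with small exchange steps takes close values
at two disjoint sets. -/
theorem exists_disjoint_abs_sub_lt (k : ℕ) (f : Finset ℕ → ℤ) (E : Finset ℕ) (a : ℤ)
    (hE : (2 * k + 2) * k ≤ E.card)
    (hf : ∀ u ⊆ E, ∀ v ⊆ E, u.card = k → v.card = k → (symmDiff u v).card ≤ 2 →
      |f u - f v| < a) :
    ∃ u ⊆ E, ∃ v ⊆ E, u.card = k ∧ v.card = k ∧ Disjoint u v ∧ |f u - f v| < a := by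
  obtain ⟨W, hW, hd⟩ := exists_pairwise_disjoint k (2 * k + 2) E hE
  -- The exchange hypothesis applied to a set and itself forces `a` to be positive.
  have ha : 0 < a := by
    have := hf (W 0) (hW 0).1 (W 0) (hW 0).1 (hW 0).2 (hW 0).2 (by simp)
    simpa using this
  have hb : ∀ i, |f (W i) - f (W 0)| ≤ k * a := fun i => by
    refine (abs_sub_le_card_sdiff_mul hf _ _ (hW i).1 (hW 0).1 (hW i).2 (hW 0).2).trans ?_
    have : ((W i \ W 0).card : ℤ) ≤ k := by
      exact_mod_cast (Finset.card_le_card Finset.sdiff_subset).trans (hW i).2.le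
    exact mul_le_mul_of_nonneg_right this ha.le
  -- The values lie within `k * a` of `f (W 0)`. Cutting this range into steps of length `a` gives
  -- at most `2 * k + 1` boxes for `2 * k + 2` sets.
  let g : Fin (2 * k + 2) → ℤ := fun i => (f (W i) - f (W 0) + k * a) / a
  have hg : ∀ i ∈ Finset.univ, g i ∈ Finset.Icc (0 : ℤ) (2 * k) := fun i _ => by
    have := abs_le.1 (hb i)
    rw [Finset.mem_Icc]
    constructor
    · exact Int.ediv_nonneg (by linarith) ha.le
    · calc g i ≤ (2 * k * a) / a := Int.ediv_le_ediv ha (by linarith)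
        _ = 2 * k := Int.mul_ediv_cancel _ ha.ne'
  obtain ⟨i, -, j, -, hij, hgij⟩ := Finset.exists_ne_map_eq_of_card_lt_of_maps_to
    (by simp) hg
  refine ⟨W i, (hW i).1, W j, (hW j).1, (hW i).2, (hW j).2, hd i j hij, ?_⟩
  -- Equal quotients leave only the difference of two remainders in `[0, a)`.
  have h1 := Int.emod_add_mul_ediv (f (W i) - f (W 0) + k * a) a
  have h2 := Int.emod_add_mul_ediv (f (W j) - f (W 0) + k * a) a
  have h3 := Int.emod_nonneg (f (W i) - f (W 0) + k * a) ha.ne'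
  have h4 := Int.emod_nonneg (f (W j) - f (W 0) + k * a) ha.ne'
  have h5 := Int.emod_lt_of_pos (f (W i) - f (W 0) + k * a) ha
  have h6 := Int.emod_lt_of_pos (f (W j) - f (W 0) + k * a) ha
  have h7 : (f (W i) - f (W 0) + k * a) / a = (f (W j) - f (W 0) + k * a) / a := hgij
  rw [h7] at h1
  rw [abs_lt]
  constructor <;> linarith

/-! ## The standard relations used -/

/-- Sets with at most `n` elements. -/
def cardLE (n : ℕ) : Set (Set ℕ) := {w | w.encard ≤ n}

/-- Pairs of sets whose symmetric difference has at most `n` elements. -/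
def closeLE (n : ℕ) : Set (Set ℕ × Set ℕ) := {p | symmDiff p.1 p.2 ∈ cardLE n}

/-- The relation `|y - z| < a`. -/
def absLt : Set ((ℕ × ℕ) × ℕ) := {p | |(p.1.1 : ℤ) - (p.1.2 : ℤ)| < (p.2 : ℤ)}

/-- Pairs of a set and one of its `k`-element subsets. -/
def subsetsOfCard (k : ℕ) : Set (Set ℕ × Set ℕ) := {p | p.2 ⊆ p.1 ∧ p.2.encard = k}

/-- Families `F` of sets such that every total relation on `F` with values in the natural numbers
that moves by less than `a` along exchanges takes values less than `a` apart at two members of `F`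
whose symmetric difference has more than `K` elements. -/
def spread (K : ℕ) : Set (Set (Set ℕ)) :=
  {F | ∀ (G : Set (Set ℕ × ℕ)) (a : ℕ), (∀ u ∈ F, ∃ y, (u, y) ∈ G) →
    (∀ u ∈ F, ∀ v ∈ F, ∀ y z, (u, v) ∈ closeLE 2 → (u, y) ∈ G → (v, z) ∈ G →
      ((y, z), a) ∈ absLt) →
    ∃ u ∈ F, ∃ v ∈ F, ∃ y z, (u, y) ∈ G ∧ (v, z) ∈ G ∧ ((y, z), a) ∈ absLt ∧
      (u, v) ∉ closeLE K}

/-! ### Elementary characterisations of the standard relations, and their combinatorics for sets -/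

/-- This recursion is expressible in the formal language, so cardinality bounds can be transferred
one step at a time. -/
theorem mem_cardLE_succ (n : ℕ) (w : Set ℕ) :
    w ∈ cardLE (n + 1) ↔ ∃ x, ∃ w' ∈ cardLE n, ∀ z ∈ w, z = x ∨ z ∈ w' := by
  constructor
  · intro h
    rcases w.eq_empty_or_nonempty with rfl | ⟨x, hx⟩
    · exact ⟨0, ∅, by simp [cardLE], by simp⟩
    · refine ⟨x, w \ {x}, ?_, fun z hz => ?_⟩
      · have h1 : w.encard ≤ (n + 1 : ℕ) := h
        rw [← Set.encard_sdiff_singleton_add_one hx] at h1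
        push_cast at h1
        exact (ENat.add_le_add_iff_right (by simp)).1 h1
      · by_cases e : z = x
        · exact .inl e
        · exact .inr ⟨hz, e⟩
  · rintro ⟨x, w', hw', h⟩
    have h1 : w'.encard ≤ n := hw'
    have h2 : w ⊆ insert x w' := fun z hz => h z hz
    refine (Set.encard_le_encard h2).trans ((Set.encard_insert_le _ _).trans ?_)
    push_cast
    gcongr

theorem mem_cardLE_zero (w : Set ℕ) : w ∈ cardLE 0 ↔ ∀ x, x ∉ w := by
  rw [← Set.eq_empty_iff_forall_notMem]
  simp [cardLE]

theorem cardLE_mono {m n : ℕ} (h : m ≤ n) : cardLE m ⊆ cardLE n :=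
  fun w hw => le_trans (show w.encard ≤ (m : ℕ∞) from hw) (by exact_mod_cast h)

theorem mem_closeLE (n : ℕ) (v w : Set ℕ) : (v, w) ∈ closeLE n ↔
    ∃ d ∈ cardLE n, ∀ x, x ∈ d ↔ (x ∈ v ∧ x ∉ w) ∨ (x ∈ w ∧ x ∉ v) := by
  constructor
  · exact fun h => ⟨symmDiff v w, h, fun x => Iff.rfl⟩
  · rintro ⟨d, hd, h⟩
    have : d = symmDiff v w := Set.ext h
    rwa [this] at hd

theorem mem_absLt (y z a : ℕ) : ((y, z), a) ∈ absLt ↔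
    ∃ d : ℕ, (d : ℤ) = |(y : ℤ) - (z : ℤ)| ∧ d < a := by
  change |(y : ℤ) - (z : ℤ)| < (a : ℤ) ↔ _
  constructor
  · intro h
    refine ⟨((y : ℤ) - (z : ℤ)).natAbs, Int.natCast_natAbs _, ?_⟩
    rw [← Int.natCast_natAbs] at h
    exact_mod_cast h
  · rintro ⟨d, hd, hlt⟩
    rw [← hd]
    exact_mod_cast hlt

theorem absLt_trans (y z a b : ℕ) (h : ((y, z), a) ∈ absLt) (hab : a < b) :
    ((y, z), b) ∈ absLt :=
  lt_trans (show |(y : ℤ) - (z : ℤ)| < (a : ℤ) from h) (by exact_mod_cast hab)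

theorem spread_anti {K L : ℕ} (h : K ≤ L) : spread L ⊆ spread K := by
  intro F hF G a h1 h2
  obtain ⟨u, hu, v, hv, y, z, hy, hz, hyz, huv⟩ := hF G a h1 h2
  exact ⟨u, hu, v, hv, y, z, hy, hz, hyz,
    fun hc => huv (cardLE_mono h hc)⟩

theorem exists_subset_finset_of_notMem_cardLE {n : ℕ} {D : Set ℕ} (h : D ∉ cardLE n) :
    ∃ E : Finset ℕ, ↑E ⊆ D ∧ n < E.card := by
  have h1 : ((n + 1 : ℕ) : ℕ∞) ≤ D.encard := by
    have : (n : ℕ∞) < D.encard := not_le.1 h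
    push_cast
    exact Order.add_one_le_of_lt this
  obtain ⟨t, ht, hc⟩ := Set.exists_subset_encard_eq h1
  lift t to Finset ℕ using Set.finite_of_encard_eq_coe hc
  refine ⟨t, ht, ?_⟩
  rw [Set.encard_coe_eq_coe_finsetCard] at hc
  have : t.card = n + 1 := by exact_mod_cast hc
  omega

theorem coe_notMem_cardLE {n : ℕ} {E : Finset ℕ} : (E : Set ℕ) ∉ cardLE n ↔ n < E.card := by
  simp [cardLE]

theorem mem_subsetsOfCard_coe {k : ℕ} {E : Finset ℕ} {u : Set ℕ} :
    ((E : Set ℕ), u) ∈ subsetsOfCard k ↔ ∃ v : Finset ℕ, v ⊆ E ∧ v.card = k ∧ ↑v = u := by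
  constructor
  · rintro ⟨h1, h2⟩
    change u ⊆ ↑E at h1
    change u.encard = k at h2
    lift u to Finset ℕ using E.finite_toSet.subset h1
    rw [Set.encard_coe_eq_coe_finsetCard] at h2
    exact ⟨u, by exact_mod_cast h1, by exact_mod_cast h2, rfl⟩
  · rintro ⟨v, h1, h2, rfl⟩
    exact ⟨by exact_mod_cast h1, by simp [h2]⟩

/-- Ramsey's theorem for a single colour class, in terms of sets of natural numbers. -/
theorem exists_ramsey_set (k p : ℕ) : ∃ N : ℕ, ∀ (D : Set ℕ) (Y : Set (Set ℕ)), D ∉ cardLE N →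
    ∃ E ∉ cardLE p, E ⊆ D ∧ ((∀ u, (E, u) ∈ subsetsOfCard k → u ∈ Y) ∨
      (∀ u, (E, u) ∈ subsetsOfCard k → u ∉ Y)) := by
  -- Lying outside `cardLE p` means having at least `p + 1` elements.
  obtain ⟨N, hN⟩ := exists_ramsey k (p + 1) (p + 1)
  refine ⟨N, fun D Y hD => ?_⟩
  obtain ⟨D', hD', hc⟩ := exists_subset_finset_of_notMem_cardLE hD
  rcases hN D' {u | ↑u ∈ Y} hc.le with ⟨E, hE, hp, h⟩ | ⟨E, hE, hp, h⟩
  all_goals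
    refine ⟨E, coe_notMem_cardLE.2 hp, (Finset.coe_subset.2 hE).trans hD', ?_⟩
    simp only [mem_subsetsOfCard_coe]
  · refine .inl ?_
    rintro _ ⟨v, h1, h2, rfl⟩
    exact h v h1 h2
  · refine .inr ?_
    rintro _ ⟨v, h1, h2, rfl⟩
    exact h v h1 h2

/-- The family of all `K + 1`-element subsets of a large set is spread. -/
theorem exists_spread (K : ℕ) (D : Set ℕ)
    (hD : D ∉ cardLE ((2 * (K + 1) + 2) * (K + 1))) :
    ∃ E ⊆ D, {u | (E, u) ∈ subsetsOfCard (K + 1)} ∈ spread K := by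
  obtain ⟨E, hE, hc⟩ := exists_subset_finset_of_notMem_cardLE hD
  refine ⟨E, hE, fun G a htot hstep => ?_⟩
  have hmem : ∀ u ⊆ E, u.card = K + 1 → (u : Set ℕ) ∈ {u | (↑E, u) ∈ subsetsOfCard (K + 1)} :=
    fun u hu hk => mem_subsetsOfCard_coe.2 ⟨u, hu, hk, rfl⟩
  -- The value 0 off the family is a dummy that lets `f` be chosen on all finite sets.
  have hG : ∀ u : Finset ℕ, ∃ y : ℕ, u ⊆ E → u.card = K + 1 → ((u : Set ℕ), y) ∈ G := fun u => by
    by_cases h : u ⊆ E ∧ u.card = K + 1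
    · obtain ⟨y, hy⟩ := htot u (hmem u h.1 h.2)
      exact ⟨y, fun _ _ => hy⟩
    · exact ⟨0, fun h1 h2 => (h ⟨h1, h2⟩).elim⟩
  choose f hf using hG
  obtain ⟨u, hu, v, hv, huk, hvk, hd, hlt⟩ := exists_disjoint_abs_sub_lt (K + 1)
    (fun u => (f u : ℤ)) E a hc.le (fun u hu v hv huk hvk h => by
      refine hstep u (hmem u hu huk) v (hmem v hv hvk) _ _ ?_ (hf u hu huk) (hf v hv hvk)
      change (symmDiff (u : Set ℕ) v).encard ≤ (2 : ℕ)
      rw [← Finset.coe_symmDiff, Set.encard_coe_eq_coe_finsetCard]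
      exact_mod_cast h)
  refine ⟨u, hmem u hu huk, v, hmem v hv hvk, f u, f v, hf u hu huk, hf v hv hvk, hlt, ?_⟩
  change ¬ (symmDiff (u : Set ℕ) v).encard ≤ (K : ℕ)
  rw [← Finset.coe_symmDiff, Set.encard_coe_eq_coe_finsetCard, hd.symmDiff_eq_sup,
    Finset.sup_eq_union, Finset.card_union_of_disjoint hd, huk, hvk, Nat.cast_le]
  omega

end Nonstandard

set_option linter.unusedSimpArgs false

namespace Nonstandard

/-! ## Notation for the innermost variables -/

/-- The innermost variable. -/
abbrev Term.v0 {Γ : List Ty} {τ : Ty} : Term (τ :: Γ) τ := .var .zero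

/-- The variable one binder out. -/
abbrev Term.v1 {Γ : List Ty} {a τ : Ty} : Term (a :: τ :: Γ) τ := .var (.succ .zero)

/-- The variable two binders out. -/
abbrev Term.v2 {Γ : List Ty} {a b τ : Ty} : Term (a :: b :: τ :: Γ) τ :=
  .var (.succ (.succ .zero))

/-- The variable three binders out. -/
abbrev Term.v3 {Γ : List Ty} {a b c τ : Ty} : Term (a :: b :: c :: τ :: Γ) τ :=
  .var (.succ (.succ (.succ .zero)))

/-- The variable four binders out. -/
abbrev Term.v4 {Γ : List Ty} {a b c d τ : Ty} : Term (a :: b :: c :: d :: τ :: Γ) τ :=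
  .var (.succ (.succ (.succ (.succ .zero))))

/-- The variable five binders out. -/
abbrev Term.v5 {Γ : List Ty} {a b c d e τ : Ty} : Term (a :: b :: c :: d :: e :: τ :: Γ) τ :=
  .var (.succ (.succ (.succ (.succ (.succ .zero)))))

/-- The variable six binders out. -/
abbrev Term.v6 {Γ : List Ty} {a b c d e f τ : Ty} :
    Term (a :: b :: c :: d :: e :: f :: τ :: Γ) τ :=
  .var (.succ (.succ (.succ (.succ (.succ (.succ .zero))))))

/-- The variable seven binders out. -/
abbrev Term.v7 {Γ : List Ty} {a b c d e f g τ : Ty} :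
    Term (a :: b :: c :: d :: e :: f :: g :: τ :: Γ) τ :=
  .var (.succ (.succ (.succ (.succ (.succ (.succ (.succ .zero)))))))

/-- The variable eight binders out. -/
abbrev Term.v8 {Γ : List Ty} {a b c d e f g h τ : Ty} :
    Term (a :: b :: c :: d :: e :: f :: g :: h :: τ :: Γ) τ :=
  .var (.succ (.succ (.succ (.succ (.succ (.succ (.succ (.succ .zero))))))))

/-- The variable nine binders out. -/
abbrev Term.v9 {Γ : List Ty} {a b c d e f g h i τ : Ty} :
    Term (a :: b :: c :: d :: e :: f :: g :: h :: i :: τ :: Γ) τ :=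
  .var (.succ (.succ (.succ (.succ (.succ (.succ (.succ (.succ (.succ .zero)))))))))

/-- The variable ten binders out. -/
abbrev Term.v10 {Γ : List Ty} {a b c d e f g h i j τ : Ty} :
    Term (a :: b :: c :: d :: e :: f :: g :: h :: i :: j :: τ :: Γ) τ :=
  .var (.succ (.succ (.succ (.succ (.succ (.succ (.succ (.succ (.succ (.succ .zero))))))))))

namespace Universe

open Formula Term

variable (M : Universe.{u})

/-! ## Pairs and internal sets -/

theorem pair_inj {σ τ : Ty} {x x' : M.Obj σ} {y y' : M.Obj τ} :
    M.pair x y = M.pair x' y' ↔ x = x' ∧ y = y' := by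
  have h := M.holds_of_valid (Γ := [σ, τ, σ, τ])
    (.iff (.eq (.pair v0 v1) (.pair v2 v3)) (.and (.eq v0 v2) (.eq v1 v3)))
    (fun ρ => by
      simp only [Formula.Holds, Formula.holds_imp, Formula.holds_iff, Formula.holds_or,
    Formula.holds_ex, Term.eval, Env.cons_zero, Env.cons_succ]
      exact Prod.mk_inj)
    (Env.cons x (Env.cons y (Env.cons x' (Env.cons y' Env.nil))))
  revert h
  simp only [Formula.Holds, Formula.holds_imp, Formula.holds_iff, Formula.holds_or,
    Formula.holds_ex, Term.eval, Env.cons_zero, Env.cons_succ]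
  exact id

theorem exists_eq_pair {σ τ : Ty} (p : M.Obj (.prod σ τ)) : ∃ x y, p = M.pair x y := by
  have h := M.holds_of_valid (Γ := [.prod σ τ])
    (.ex σ (.ex τ (.eq v2 (.pair v1 v0))))
    (fun ρ => by
      simp only [Formula.Holds, Formula.holds_imp, Formula.holds_iff, Formula.holds_or,
    Formula.holds_ex, Term.eval, Env.cons_zero, Env.cons_succ]
      exact ⟨_, _, rfl⟩)
    (Env.cons p Env.nil)
  revert h
  simp only [Formula.Holds, Formula.holds_imp, Formula.holds_iff, Formula.holds_or,
    Formula.holds_ex, Term.eval, Env.cons_zero, Env.cons_succ]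
  exact id

/-- A predicate on internal objects is internal if it is membership in an internal set. -/
def IsInternal {τ : Ty} (P : M.Obj τ → Prop) : Prop :=
  ∃ A : M.Obj (.set τ), ∀ x, M.mem x A ↔ P x

variable {M}

theorem isInternal_mem {τ : Ty} (A : M.Obj (.set τ)) : M.IsInternal (fun x => M.mem x A) :=
  ⟨A, fun _ => Iff.rfl⟩

theorem IsInternal.not {τ : Ty} {P : M.Obj τ → Prop} (hP : M.IsInternal P) :
    M.IsInternal (fun x => ¬ P x) := by
  obtain ⟨A, hA⟩ := hP
  obtain ⟨B, hB⟩ := M.comprehension (Γ := [.set τ]) (.not (.mem v0 v1)) (Env.cons A Env.nil)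
  exact ⟨B, fun x => (hB x).trans (not_congr (hA x))⟩

theorem IsInternal.and {τ : Ty} {P Q : M.Obj τ → Prop} (hP : M.IsInternal P)
    (hQ : M.IsInternal Q) : M.IsInternal (fun x => P x ∧ Q x) := by
  obtain ⟨A, hA⟩ := hP
  obtain ⟨A', hA'⟩ := hQ
  obtain ⟨B, hB⟩ := M.comprehension (Γ := [.set τ, .set τ])
    (.and (.mem v0 v1) (.mem v0 v2)) (Env.cons A (Env.cons A' Env.nil))
  exact ⟨B, fun x => (hB x).trans (and_congr (hA x) (hA' x))⟩

theorem IsInternal.congr {τ : Ty} {P Q : M.Obj τ → Prop} (hP : M.IsInternal P)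
    (h : ∀ x, P x ↔ Q x) : M.IsInternal Q := by
  obtain ⟨A, hA⟩ := hP
  exact ⟨A, fun x => (hA x).trans (h x)⟩

theorem IsInternal.iff_const {τ : Ty} {P : M.Obj τ → Prop} (hP : M.IsInternal P) (q : Prop) :
    M.IsInternal (fun x => P x ↔ q) := by
  by_cases h : q
  · simpa [h] using hP
  · simpa [h] using hP.not

theorem isInternal_true {τ : Ty} : M.IsInternal (fun _ : M.Obj τ => True) := by
  obtain ⟨B, hB⟩ := M.comprehension (Γ := []) (.eq (τ := τ) v0 v0) Env.nil
  exact ⟨B, fun x => (hB x).trans (by simp [Formula.Holds])⟩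

theorem IsInternal.fiber {σ τ : Ty} {P : M.Obj (.prod σ τ) → Prop} (hP : M.IsInternal P)
    (x : M.Obj σ) : M.IsInternal (fun y => P (M.pair x y)) := by
  obtain ⟨A, hA⟩ := hP
  obtain ⟨B, hB⟩ := M.comprehension (Γ := [.set (.prod σ τ), σ])
    (.mem (.pair v2 v0) v1) (Env.cons A (Env.cons x Env.nil))
  exact ⟨B, fun y => (hB y).trans (hA _)⟩

theorem IsInternal.exists_snd {σ τ : Ty} {P : M.Obj (.prod σ τ) → Prop} (hP : M.IsInternal P) :
    M.IsInternal (fun x => ∃ y, P (M.pair x y)) := by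
  obtain ⟨A, hA⟩ := hP
  obtain ⟨B, hB⟩ := M.comprehension (Γ := [.set (.prod σ τ)])
    (.ex τ (.mem (.pair v1 v0) v2)) (Env.cons A Env.nil)
  refine ⟨B, fun x => (hB x).trans ?_⟩
  simp only [Formula.Holds, Formula.holds_imp, Formula.holds_iff, Formula.holds_or,
    Formula.holds_ex, Term.eval, Env.cons_zero, Env.cons_succ]
  exact exists_congr fun y => hA _

theorem IsInternal.forall_lt {τ : Ty} {P : ℕ → M.Obj τ → Prop} (hP : ∀ n, M.IsInternal (P n))
    (n : ℕ) : M.IsInternal (fun x => ∀ m < n, P m x) := by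
  induction n with
  | zero => exact isInternal_true.congr (by simp)
  | succ n ih => exact (ih.and (hP n)).congr fun x => by rw [Nat.forall_lt_succ_right]

/-- Countable saturation for internal predicates. -/
theorem exists_forall_of_isInternal {τ : Ty} {P : ℕ → M.Obj τ → Prop}
    (hP : ∀ n, M.IsInternal (P n)) (h : ∀ n, ∃ x, ∀ m < n, P m x) : ∃ x, ∀ m, P m x := by
  choose A hA using hP
  obtain ⟨x, hx⟩ := M.saturation A fun n => by
    obtain ⟨x, hx⟩ := h n
    exact ⟨x, fun m hm => (hA m x).2 (hx m hm)⟩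
  exact ⟨x, fun m => (hA m x).1 (hx m)⟩

/-- Countable saturation for a decreasing sequence of internal predicates. -/
theorem exists_forall_of_antitone {τ : Ty} {P : ℕ → M.Obj τ → Prop}
    (hP : ∀ n, M.IsInternal (P n)) (hanti : ∀ m n x, m ≤ n → P n x → P m x)
    (h : ∀ n, ∃ x, P n x) : ∃ x, ∀ m, P m x :=
  exists_forall_of_isInternal hP fun n =>
    (h n).imp fun x hx m hm => hanti m n x hm.le hx

variable (M)

/-! ## Internal cardinality -/

/-- Internal sets with at most `n` elements. -/
abbrev CardLE (n : ℕ) (w : M.Obj (.set .nat)) : Prop :=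
  M.mem w (M.star (τ := .set (.set .nat)) (cardLE n))

/-- Internal sets whose symmetric difference has at most `n` elements. -/
abbrev CloseLE (n : ℕ) (v w : M.Obj (.set .nat)) : Prop :=
  M.mem (M.pair v w) (M.star (τ := .set (.prod (.set .nat) (.set .nat))) (closeLE n))

/-- The relation `|y - z| < a` on hypernatural numbers. -/
abbrev AbsLt (y z a : M.HyperNat) : Prop :=
  M.mem (M.pair (M.pair y z) a) (M.star (τ := .set (.prod (.prod .nat .nat) .nat)) absLt)

/-- `u` is a `k`-element internal subset of `E`. -/
abbrev IsSubsetOfCard (k : ℕ) (E u : M.Obj (.set .nat)) : Prop :=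
  M.mem (M.pair E u) (M.star (τ := .set (.prod (.set .nat) (.set .nat))) (subsetsOfCard k))

/-- Internal spread families. -/
abbrev Spread (K : ℕ) (F : M.Obj (.set (.set .nat))) : Prop :=
  M.mem F (M.star (τ := .set (.set (.set .nat))) (spread K))

variable {M}

theorem cardLE_zero_iff (w : M.Obj (.set .nat)) : M.CardLE 0 w ↔ ∀ x, ¬ M.mem x w := by
  have h := (M.transfer (Γ := [.set (.set .nat)])
    (.all (.set .nat) (.iff (.mem v0 v1) (.all .nat (.not (.mem v0 v1)))))
    (Env.cons (cardLE 0) Env.nil)).1 (by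
      simp only [Formula.Holds, Formula.holds_imp, Formula.holds_iff, Formula.holds_or,
    Formula.holds_ex, Term.eval, Env.cons_zero, Env.cons_succ]
      exact mem_cardLE_zero)
  revert h
  simp only [Formula.Holds, Formula.holds_imp, Formula.holds_iff, Formula.holds_or,
    Formula.holds_ex, Term.eval, Env.cons_zero, Env.cons_succ]
  exact fun h => h w

theorem cardLE_succ_iff (n : ℕ) (w : M.Obj (.set .nat)) : M.CardLE (n + 1) w ↔
    ∃ x w', M.CardLE n w' ∧ ∀ z, M.mem z w → z = x ∨ M.mem z w' := by
  have h := (M.transfer (Γ := [.set (.set .nat), .set (.set .nat)])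
    (.all (.set .nat) (.iff (.mem v0 v2) (.ex .nat (.ex (.set .nat) (.and (.mem v0 v3)
      (.all .nat (.imp (.mem v0 v3) (.or (.eq v0 v2) (.mem v0 v1)))))))))
    (Env.cons (cardLE n) (Env.cons (cardLE (n + 1)) Env.nil))).1 (by
      simp only [Formula.Holds, Formula.holds_imp, Formula.holds_iff, Formula.holds_or,
    Formula.holds_ex, Term.eval, Env.cons_zero, Env.cons_succ]
      exact fun w => mem_cardLE_succ n w)
  revert h
  simp only [Formula.Holds, Formula.holds_imp, Formula.holds_iff, Formula.holds_or,
    Formula.holds_ex, Term.eval, Env.cons_zero, Env.cons_succ]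
  exact fun h => h w

/-- True finiteness is not an internal notion. Peeling off one point at a time writes it as a
countable union of the internal conditions `CardLE n`. -/
theorem finite_iff_exists_cardLE (w : M.Obj (.set .nat)) :
    (M.elems w).Finite ↔ ∃ n, M.CardLE n w := by
  constructor
  · intro h
    -- The induction runs on an external finite superset. The internal set shrinks along with it,
    -- staying internal by comprehension.
    suffices ∀ (s : Set M.HyperNat), s.Finite → ∀ w, M.elems w ⊆ s → ∃ n, M.CardLE n w from
      this _ h w subset_rfl
    intro s hs
    induction s, hs using Set.Finite.induction_on with
    | empty => exact fun w hw => ⟨0, (cardLE_zero_iff w).2 fun x hx => hw hx⟩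
    | @insert a s _ _ ih =>
      intro w hw
      obtain ⟨w', hw'⟩ := M.comprehension (Γ := [.set .nat, .nat])
        (.and (.mem v0 v1) (.not (.eq v0 v2))) (Env.cons w (Env.cons a Env.nil))
      have hw'' : ∀ x, M.mem x w' ↔ M.mem x w ∧ ¬ x = a := hw'
      obtain ⟨n, hn⟩ := ih w' fun x hx =>
        (hw ((hw'' x).1 hx).1).resolve_left ((hw'' x).1 hx).2
      refine ⟨n + 1, (cardLE_succ_iff n w).2 ⟨a, w', hn, fun z hz => ?_⟩⟩
      by_cases e : z = a
      · exact .inl e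
      · exact .inr ((hw'' z).2 ⟨hz, e⟩)
  · rintro ⟨n, h⟩
    induction n generalizing w with
    | zero =>
      have : M.elems w = ∅ := Set.eq_empty_iff_forall_notMem.2 ((cardLE_zero_iff w).1 h)
      rw [this]
      exact Set.finite_empty
    | succ n ih =>
      obtain ⟨x, w', hw', hz⟩ := (cardLE_succ_iff n w).1 h
      exact ((ih w' hw').insert x).subset fun z hz' => hz z hz'

theorem closeLE_iff (n : ℕ) (v w : M.Obj (.set .nat)) : M.CloseLE n v w ↔
    ∃ d, M.CardLE n d ∧ M.elems d = symmDiff (M.elems v) (M.elems w) := by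
  have h := (M.transfer (Γ := [.set (.set .nat), .set (.prod (.set .nat) (.set .nat))])
    (.all (.set .nat) (.all (.set .nat) (.iff (.mem (.pair v1 v0) v3)
      (.ex (.set .nat) (.and (.mem v0 v3) (.all .nat (.iff (.mem v0 v1)
        (.or (.and (.mem v0 v3) (.not (.mem v0 v2)))
          (.and (.mem v0 v2) (.not (.mem v0 v3)))))))))))
    (Env.cons (cardLE n) (Env.cons (closeLE n) Env.nil))).1 (by
      simp only [Formula.Holds, Formula.holds_imp, Formula.holds_iff, Formula.holds_or,
    Formula.holds_ex, Term.eval, Env.cons_zero, Env.cons_succ]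
      exact fun v w => mem_closeLE n v w)
  revert h
  simp only [Formula.Holds, Formula.holds_imp, Formula.holds_iff, Formula.holds_or,
    Formula.holds_ex, Term.eval, Env.cons_zero, Env.cons_succ]
  intro h
  refine (h v w).trans (exists_congr fun d => and_congr Iff.rfl ?_)
  exact Set.ext_iff.symm

/-- The symmetric difference of internal sets is internal, so `finite_iff_exists_cardLE` applies to
it. This exhibits `FD` as a countable union of internal relations, the form that saturation needs.
-/
theorem fd_iff_exists_closeLE (v w : M.Obj (.set .nat)) :
    M.FD v w ↔ ∃ n, M.CloseLE n v w := by
  obtain ⟨d, hd⟩ := M.comprehension (Γ := [.set .nat, .set .nat])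
    (.or (.and (.mem v0 v1) (.not (.mem v0 v2))) (.and (.mem v0 v2) (.not (.mem v0 v1))))
    (Env.cons v (Env.cons w Env.nil))
  have hd' : M.elems d = symmDiff (M.elems v) (M.elems w) := by
    ext x
    refine (hd x).trans ?_
    simp only [Formula.Holds, Formula.holds_imp, Formula.holds_iff, Formula.holds_or,
    Formula.holds_ex, Term.eval, Env.cons_zero, Env.cons_succ]
    exact Iff.rfl
  constructor
  · intro h
    rw [FD, ← hd', finite_iff_exists_cardLE] at h
    exact h.imp fun n hn => (closeLE_iff n v w).2 ⟨d, hn, hd'⟩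
  · rintro ⟨n, hn⟩
    obtain ⟨d, h, e⟩ := (closeLE_iff n v w).1 hn
    rw [FD, ← e]
    exact (finite_iff_exists_cardLE d).2 ⟨n, h⟩

theorem CloseLE.mono {m n : ℕ} (h : m ≤ n) {v w : M.Obj (.set .nat)} (hc : M.CloseLE m v w) :
    M.CloseLE n v w := by
  have h := (M.transfer (Γ := [.set (.prod (.set .nat) (.set .nat)),
      .set (.prod (.set .nat) (.set .nat))])
    (.all (.prod (.set .nat) (.set .nat)) (.imp (.mem v0 v1) (.mem v0 v2)))
    (Env.cons (closeLE m) (Env.cons (closeLE n) Env.nil))).1 (by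
      simp only [Formula.Holds, Formula.holds_imp, Formula.holds_iff, Formula.holds_or,
    Formula.holds_ex, Term.eval, Env.cons_zero, Env.cons_succ]
      exact fun p hp => cardLE_mono h hp)
  revert h
  simp only [Formula.Holds, Formula.holds_imp, Formula.holds_iff, Formula.holds_or,
    Formula.holds_ex, Term.eval, Env.cons_zero, Env.cons_succ]
  exact fun h => h _ hc

/-! ## Distances -/

theorem absLt_iff (y z a : M.HyperNat) :
    M.AbsLt y z a ↔ ∃ d, M.IsAbsDiff y z d ∧ M.Lt d a := by
  have h := (M.transfer (Γ := [.set (.prod (.prod .nat .nat) .nat),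
      .set (.prod (.prod .nat .nat) .nat), .set (.prod .nat .nat)])
    (.all .nat (.all .nat (.all .nat (.iff (.mem (.pair (.pair v2 v1) v0) v3)
      (.ex .nat (.and (.mem (.pair (.pair v3 v2) v0) v5) (.mem (.pair v0 v1) v6)))))))
    (Env.cons absLt (Env.cons
      {p : (ℕ × ℕ) × ℕ | (p.2 : ℤ) = |(p.1.1 : ℤ) - (p.1.2 : ℤ)|}
      (Env.cons {p : ℕ × ℕ | p.1 < p.2} Env.nil)))).1 (by
      simp only [Formula.Holds, Formula.holds_imp, Formula.holds_iff, Formula.holds_or,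
    Formula.holds_ex, Term.eval, Env.cons_zero, Env.cons_succ]
      exact mem_absLt)
  revert h
  simp only [Formula.Holds, Formula.holds_imp, Formula.holds_iff, Formula.holds_or,
    Formula.holds_ex, Term.eval, Env.cons_zero, Env.cons_succ]
  exact fun h => h y z a

theorem AbsLt.trans_lt {y z a b : M.HyperNat} (h : M.AbsLt y z a) (hab : M.Lt a b) :
    M.AbsLt y z b := by
  have ht := (M.transfer (Γ := [.set (.prod (.prod .nat .nat) .nat), .set (.prod .nat .nat)])
    (.all .nat (.all .nat (.all .nat (.all .nat (.imp (.mem (.pair (.pair v3 v2) v1) v4)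
      (.imp (.mem (.pair v1 v0) v5) (.mem (.pair (.pair v3 v2) v0) v4)))))))
    (Env.cons absLt (Env.cons {p : ℕ × ℕ | p.1 < p.2} Env.nil))).1 (by
      simp only [Formula.Holds, Formula.holds_imp, Formula.holds_iff, Formula.holds_or,
    Formula.holds_ex, Term.eval, Env.cons_zero, Env.cons_succ]
      exact absLt_trans)
  revert ht
  simp only [Formula.Holds, Formula.holds_imp, Formula.holds_iff, Formula.holds_or,
    Formula.holds_ex, Term.eval, Env.cons_zero, Env.cons_succ]
  exact fun ht => ht y z a b h hab

/-! ## Combinatorics in the nonstandard universe -/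

theorem IsSubsetOfCard.subset {k : ℕ} {E u : M.Obj (.set .nat)} (h : M.IsSubsetOfCard k E u) :
    M.elems u ⊆ M.elems E := by
  have ht := (M.transfer (Γ := [.set (.prod (.set .nat) (.set .nat))])
    (.all (.set .nat) (.all (.set .nat) (.imp (.mem (.pair v1 v0) v2)
      (.all .nat (.imp (.mem v0 v1) (.mem v0 v2))))))
    (Env.cons (subsetsOfCard k) Env.nil)).1 (by
      simp only [Formula.Holds, Formula.holds_imp, Formula.holds_iff, Formula.holds_or,
    Formula.holds_ex, Term.eval, Env.cons_zero, Env.cons_succ]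
      exact fun E u h x hx => h.1 hx)
  revert ht
  simp only [Formula.Holds, Formula.holds_imp, Formula.holds_iff, Formula.holds_or,
    Formula.holds_ex, Term.eval, Env.cons_zero, Env.cons_succ]
  exact fun ht => ht E u h

theorem IsSubsetOfCard.mono {k : ℕ} {E E' u : M.Obj (.set .nat)} (h : M.IsSubsetOfCard k E u)
    (hE : M.elems E ⊆ M.elems E') : M.IsSubsetOfCard k E' u := by
  have ht := (M.transfer (Γ := [.set (.prod (.set .nat) (.set .nat))])
    (.all (.set .nat) (.all (.set .nat) (.all (.set .nat) (.imp (.mem (.pair v2 v0) v3)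
      (.imp (.all .nat (.imp (.mem v0 v3) (.mem v0 v2))) (.mem (.pair v1 v0) v3))))))
    (Env.cons (subsetsOfCard k) Env.nil)).1 (by
      simp only [Formula.Holds, Formula.holds_imp, Formula.holds_iff, Formula.holds_or,
    Formula.holds_ex, Term.eval, Env.cons_zero, Env.cons_succ]
      exact fun E E' u h hE => ⟨fun x hx => hE x (h.1 hx), h.2⟩)
  revert ht
  simp only [Formula.Holds, Formula.holds_imp, Formula.holds_iff, Formula.holds_or,
    Formula.holds_ex, Term.eval, Env.cons_zero, Env.cons_succ]
  exact fun ht => ht E E' u h fun x hx => hE hx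

theorem exists_homogeneous_one (k p : ℕ) : ∃ N : ℕ, ∀ D Y, ¬ M.CardLE N D →
    ∃ E, ¬ M.CardLE p E ∧ M.elems E ⊆ M.elems D ∧
      ((∀ u, M.IsSubsetOfCard k E u → M.mem u Y) ∨
        (∀ u, M.IsSubsetOfCard k E u → ¬ M.mem u Y)) := by
  obtain ⟨N, hN⟩ := exists_ramsey_set k p
  have ht := (M.transfer (Γ := [.set (.set .nat), .set (.set .nat),
      .set (.prod (.set .nat) (.set .nat))])
    (.all (.set .nat) (.all (.set (.set .nat)) (.imp (.not (.mem v1 v2))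
      (.ex (.set .nat) (.and (.not (.mem v0 v4)) (.and
        (.all .nat (.imp (.mem v0 v1) (.mem v0 v3)))
        (.or (.all (.set .nat) (.imp (.mem (.pair v1 v0) v6) (.mem v0 v2)))
          (.all (.set .nat) (.imp (.mem (.pair v1 v0) v6) (.not (.mem v0 v2)))))))))))
    (Env.cons (cardLE N) (Env.cons (cardLE p) (Env.cons (subsetsOfCard k) Env.nil)))).1 (by
      simp only [Formula.Holds, Formula.holds_imp, Formula.holds_iff, Formula.holds_or,
    Formula.holds_ex, Term.eval, Env.cons_zero, Env.cons_succ]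
      exact fun D Y hD => hN D Y hD)
  refine ⟨N, ?_⟩
  revert ht
  simp only [Formula.Holds, Formula.holds_imp, Formula.holds_iff, Formula.holds_or,
    Formula.holds_ex, Term.eval, Env.cons_zero, Env.cons_succ]
  exact id

/-- Ramsey's theorem is iterated, one colouring at a time; homogeneity survives passing to subsets.
The bound `N` is standard and does not depend on the colourings. -/
theorem exists_homogeneous (k p m : ℕ) : ∃ N : ℕ, ∀ D, ¬ M.CardLE N D →
    ∀ Y : ℕ → M.Obj (.set (.set .nat)), ∃ E, ¬ M.CardLE p E ∧ M.elems E ⊆ M.elems D ∧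
      ∀ i < m, ((∀ u, M.IsSubsetOfCard k E u → M.mem u (Y i)) ∨
        (∀ u, M.IsSubsetOfCard k E u → ¬ M.mem u (Y i))) := by
  induction m generalizing p with
  | zero => exact ⟨p, fun D hD Y => ⟨D, hD, subset_rfl, by simp⟩⟩
  | succ m ih =>
    obtain ⟨N₁, h₁⟩ := exists_homogeneous_one (M := M) k p
    obtain ⟨N, hN⟩ := ih N₁
    refine ⟨N, fun D hD Y => ?_⟩
    obtain ⟨E, hE, hED, hh⟩ := hN D hD Y
    obtain ⟨E', hE', hE'E, hh'⟩ := h₁ E (Y m) hE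
    refine ⟨E', hE', hE'E.trans hED, Nat.forall_lt_succ_right.2 ⟨fun i hi => ?_, hh'⟩⟩
    exact (hh i hi).imp (fun h u hu => h u (hu.mono hE'E)) (fun h u hu => h u (hu.mono hE'E))

theorem exists_spread_family (K : ℕ) : ∃ N : ℕ, ∀ D, ¬ M.CardLE N D →
    ∃ F E, M.Spread K F ∧ M.elems E ⊆ M.elems D ∧
      ∀ u, M.mem u F → M.IsSubsetOfCard (K + 1) E u := by
  refine ⟨(2 * (K + 1) + 2) * (K + 1), ?_⟩
  have ht := (M.transfer (Γ := [.set (.set .nat), .set (.set (.set .nat)),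
      .set (.prod (.set .nat) (.set .nat))])
    (.all (.set .nat) (.imp (.not (.mem v0 v1)) (.ex (.set (.set .nat)) (.ex (.set .nat)
      (.and (.mem v1 v4) (.and (.all .nat (.imp (.mem v0 v1) (.mem v0 v3)))
        (.all (.set .nat) (.imp (.mem v0 v2) (.mem (.pair v1 v0) v6)))))))))
    (Env.cons (cardLE ((2 * (K + 1) + 2) * (K + 1))) (Env.cons (spread K)
      (Env.cons (subsetsOfCard (K + 1)) Env.nil)))).1 (by
      simp only [Formula.Holds, Formula.holds_imp, Formula.holds_iff, Formula.holds_or,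
    Formula.holds_ex, Term.eval, Env.cons_zero, Env.cons_succ]
      intro D hD
      obtain ⟨E, hE, hF⟩ := exists_spread K D hD
      exact ⟨_, E, hF, fun x hx => hE hx, fun u hu => hu⟩)
  revert ht
  simp only [Formula.Holds, Formula.holds_imp, Formula.holds_iff, Formula.holds_or,
    Formula.holds_ex, Term.eval, Env.cons_zero, Env.cons_succ]
  exact id

theorem Spread.anti {K L : ℕ} (h : K ≤ L) {F : M.Obj (.set (.set .nat))} (hF : M.Spread L F) :
    M.Spread K F := by
  have ht := (M.transfer (Γ := [.set (.set (.set .nat)), .set (.set (.set .nat))])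
    (.all (.set (.set .nat)) (.imp (.mem v0 v1) (.mem v0 v2)))
    (Env.cons (spread L) (Env.cons (spread K) Env.nil))).1 (by
      simp only [Formula.Holds, Formula.holds_imp, Formula.holds_iff, Formula.holds_or,
    Formula.holds_ex, Term.eval, Env.cons_zero, Env.cons_succ]
      exact fun F hF => spread_anti h hF)
  revert ht
  simp only [Formula.Holds, Formula.holds_imp, Formula.holds_iff, Formula.holds_or,
    Formula.holds_ex, Term.eval, Env.cons_zero, Env.cons_succ]
  exact fun ht => ht F hF

/-- After transfer only internal relations `G` are covered. They need not be single-valued, which is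
what allows an internal approximation of the graph of `θ` to be used. -/
theorem Spread.exists_far {K : ℕ} {F : M.Obj (.set (.set .nat))} (hF : M.Spread K F)
    (G : M.Obj (.set (.prod (.set .nat) .nat))) (a : M.HyperNat)
    (htot : ∀ u, M.mem u F → ∃ y, M.mem (M.pair u y) G)
    (hstep : ∀ u, M.mem u F → ∀ v, M.mem v F → ∀ y z, M.CloseLE 2 u v → M.mem (M.pair u y) G →
      M.mem (M.pair v z) G → M.AbsLt y z a) :
    ∃ u, M.mem u F ∧ ∃ v, M.mem v F ∧ ∃ y z, M.mem (M.pair u y) G ∧ M.mem (M.pair v z) G ∧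
      M.AbsLt y z a ∧ ¬ M.CloseLE K u v := by
  have ht := (M.transfer (Γ := [.set (.set (.set .nat)), .set (.prod (.set .nat) (.set .nat)),
      .set (.prod (.set .nat) (.set .nat)), .set (.prod (.prod .nat .nat) .nat)])
    (.all (.set (.set .nat)) (.all (.set (.prod (.set .nat) .nat)) (.all .nat
      (.imp (.mem v2 v3)
      (.imp (.all (.set .nat) (.imp (.mem v0 v3) (.ex .nat (.mem (.pair v1 v0) v3))))
      (.imp (.all (.set .nat) (.imp (.mem v0 v3) (.all (.set .nat) (.imp (.mem v0 v4)
        (.all .nat (.all .nat (.imp (.mem (.pair v3 v2) v8)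
          (.imp (.mem (.pair v3 v1) v5) (.imp (.mem (.pair v2 v0) v5)
            (.mem (.pair (.pair v1 v0) v4) v10))))))))))
      (.ex (.set .nat) (.and (.mem v0 v3) (.ex (.set .nat) (.and (.mem v0 v4)
        (.ex .nat (.ex .nat (.and (.mem (.pair v3 v1) v5) (.and (.mem (.pair v2 v0) v5)
          (.and (.mem (.pair (.pair v1 v0) v4) v10)
            (.not (.mem (.pair v3 v2) v9)))))))))))))))))
    (Env.cons (spread K) (Env.cons (closeLE 2) (Env.cons (closeLE K)
      (Env.cons absLt Env.nil))))).1 (by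
      simp only [Formula.Holds, Formula.holds_imp, Formula.holds_iff, Formula.holds_or,
    Formula.holds_ex, Term.eval, Env.cons_zero, Env.cons_succ]
      exact fun F G a hF h1 h2 => hF G a h1 h2)
  revert ht
  simp only [Formula.Holds, Formula.holds_imp, Formula.holds_iff, Formula.holds_or,
    Formula.holds_ex, Term.eval, Env.cons_zero, Env.cons_succ]
  exact fun ht => ht F G a hF htot hstep

/-! ## Countably determined sets and types of points -/

/-- The index set `b` in the union must be the full type of the point. The condition that the point
lies in some `A m` is needed separately, for the case of the empty type. -/
theorem IsCD.exists_types {τ : Ty} {X : Set (M.Obj τ)} (hX : M.IsCD X) :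
    ∃ (A : ℕ → M.Obj (.set τ)) (B : Set (Set ℕ)),
      ∀ p, p ∈ X ↔ (∃ m, M.mem p (A m)) ∧ {m | M.mem p (A m)} ∈ B := by
  obtain ⟨A, B, rfl⟩ := hX
  refine ⟨A, B, fun p => ?_⟩
  simp only [Set.mem_iUnion, Set.mem_inter_iff, Set.mem_iInter, Set.mem_sdiff, elems,
    Set.mem_ofPred_eq, Set.mem_compl_iff]
  constructor
  · rintro ⟨b, hb, h1, h2⟩
    have e : {m | M.mem p (A m)} = b :=
      Set.ext fun m => ⟨fun h => by_contra fun hm => (h2 m hm).2 h, h1 m⟩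
    refine ⟨?_, by rwa [e]⟩
    by_cases h0 : 0 ∈ b
    · exact ⟨0, h1 0 h0⟩
    · exact (h2 0 h0).1
  · rintro ⟨h, hb⟩
    exact ⟨_, hb, fun m hm => hm, fun m hm => ⟨h, hm⟩⟩

/-- The point `p` belongs to exactly those of the first `n` sets whose index lies in `s`. -/
def HasPattern {τ : Ty} (A : ℕ → M.Obj (.set τ)) (s : Set ℕ) (n : ℕ) (p : M.Obj τ) : Prop :=
  ∀ m < n, (M.mem p (A m) ↔ m ∈ s)

theorem isInternal_hasPattern {τ : Ty} (A : ℕ → M.Obj (.set τ)) (s : Set ℕ) (n : ℕ) :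
    M.IsInternal (HasPattern A s n) :=
  IsInternal.forall_lt (fun m => (isInternal_mem (A m)).iff_const (m ∈ s)) n

theorem HasPattern.anti {τ : Ty} {A : ℕ → M.Obj (.set τ)} {s : Set ℕ} {m n : ℕ} (h : m ≤ n)
    {p : M.Obj τ} (hp : HasPattern A s n p) : HasPattern A s m p :=
  fun i hi => hp i (hi.trans_le h)

theorem hasPattern_congr {τ : Ty} {A : ℕ → M.Obj (.set τ)} {s t : Set ℕ} {n : ℕ}
    (h : ∀ m < n, (m ∈ s ↔ m ∈ t)) (p : M.Obj τ) : HasPattern A s n p ↔ HasPattern A t n p :=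
  forall₂_congr fun m hm => by rw [h m hm]

/-! ## A rich homogeneous family of internal sets -/

/-- All members of `F` agree on every `Y i`, and `F` is spread for every standard `K`. The first `m`
of these demands are met by a family of `m + 1`-element subsets of a homogeneous set, which exists
because `D` is infinite. Saturation meets them all at once. -/
theorem exists_homogeneous_family {D : M.Obj (.set .nat)} (hD : (M.elems D).Infinite)
    (Y : ℕ → M.Obj (.set (.set .nat))) :
    ∃ F : M.Obj (.set (.set .nat)), (∀ u, M.mem u F → M.elems u ⊆ M.elems D) ∧
      (∀ K, M.Spread K F) ∧
      ∀ i, (∀ u, M.mem u F → M.mem u (Y i)) ∨ (∀ u, M.mem u F → ¬ M.mem u (Y i)) := by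
  have hcard : ∀ n, ¬ M.CardLE n D := fun n hn => hD ((finite_iff_exists_cardLE D).2 ⟨n, hn⟩)
  suffices h : ∃ F : M.Obj (.set (.set .nat)), ∀ m,
      (∀ u, M.mem u F → ∀ x, M.mem x u → M.mem x D) ∧ M.Spread m F ∧
      ((∀ u, M.mem u F → M.mem u (Y m)) ∨ (∀ u, M.mem u F → ¬ M.mem u (Y m))) by
    obtain ⟨F, hF⟩ := h
    exact ⟨F, fun u hu x hx => (hF 0).1 u hu x hx, fun K => (hF K).2.1, fun i => (hF i).2.2⟩
  refine exists_forall_of_isInternal (fun m => ?_) fun m => ?_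
  · obtain ⟨B, hB⟩ := M.comprehension
      (Γ := [.set .nat, .set (.set (.set .nat)), .set (.set .nat)])
      (.and (.all (.set .nat) (.imp (.mem v0 v1) (.all .nat (.imp (.mem v0 v1) (.mem v0 v3)))))
        (.and (.mem v0 v2) (.or (.all (.set .nat) (.imp (.mem v0 v1) (.mem v0 v4)))
          (.all (.set .nat) (.imp (.mem v0 v1) (.not (.mem v0 v4)))))))
      (Env.cons D (Env.cons (M.star (τ := .set (.set (.set .nat))) (spread m))
        (Env.cons (Y m) Env.nil)))
    refine ⟨B, fun F => (hB F).trans ?_⟩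
    simp only [Formula.Holds, Formula.holds_imp, Formula.holds_iff, Formula.holds_or,
    Formula.holds_ex, Term.eval, Env.cons_zero, Env.cons_succ]
  · obtain ⟨p, hp⟩ := exists_spread_family (M := M) m
    obtain ⟨N, hN⟩ := exists_homogeneous (M := M) (m + 1) p m
    obtain ⟨E, hE, hED, hh⟩ := hN D (hcard N) Y
    obtain ⟨F, E', hF, hE', hFE'⟩ := hp E hE
    have hFE : ∀ u, M.mem u F → M.IsSubsetOfCard (m + 1) E u := fun u hu => (hFE' u hu).mono hE'
    exact ⟨F, fun i hi => ⟨fun u hu x hx => hED ((hFE u hu).subset hx), hF.anti hi.le,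
      (hh i hi).imp (fun h u hu => h u (hFE u hu)) (fun h u hu => h u (hFE u hu))⟩⟩

/-! ### The graph of a countably determined map over a rich family -/

theorem Spread.nonempty {K : ℕ} {F : M.Obj (.set (.set .nat))} (hF : M.Spread K F) :
    ∃ u, M.mem u F := by
  by_contra h
  push Not at h
  -- Over an empty family both hypotheses are vacuous, yet the conclusion produces a member; the
  -- relation and the bound are arbitrary.
  obtain ⟨u, hu, -⟩ := hF.exists_far (M.star (τ := .set (.prod (.set .nat) .nat)) Set.univ)
    (M.star (τ := .nat) (0 : ℕ)) (fun u hu => (h u hu).elim) (fun u hu => (h u hu).elim)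
  exact h u hu

/-- Every map with countably determined graph coincides, on a rich family of internal subsets of
an infinite internal set, with the intersection of a decreasing sequence of internal relations. -/
theorem exists_family_graph {D : M.Obj (.set .nat)} (hD : (M.elems D).Infinite)
    (θ : M.internalSubsets D → M.HyperNat)
    (hθ : M.IsCD {p : M.Obj (.prod (.set .nat) .nat) | ∃ x : M.internalSubsets D,
      p = M.pair (x : M.Obj (.set .nat)) (θ x)}) :
    ∃ (F : M.Obj (.set (.set .nat))) (G : ℕ → M.Obj (.set (.prod (.set .nat) .nat))),
      (∀ K, M.Spread K F) ∧ (∀ u, M.mem u F → u ∈ M.internalSubsets D) ∧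
      (∀ m n p, m ≤ n → M.mem p (G n) → M.mem p (G m)) ∧
      ∀ u : M.internalSubsets D, M.mem (u : M.Obj (.set .nat)) F →
        ∀ y, (∀ n, M.mem (M.pair (u : M.Obj (.set .nat)) y) (G n)) ↔ y = θ u := by
  obtain ⟨A, B, hAB⟩ := hθ.exists_types
  -- There are only countably many pairs of a length and a finite pattern. The set `Y i` collects
  -- the `u` over which the `i`-th pattern is realised.
  obtain ⟨e, he⟩ := exists_surjective_nat (ℕ × Finset ℕ)
  have hY : ∀ i, M.IsInternal fun u => ∃ y, HasPattern A (e i).2 (e i).1 (M.pair u y) :=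
    fun i => (isInternal_hasPattern A _ _).exists_snd
  choose Y hY using hY
  obtain ⟨F, hFD, hF, hhom⟩ := exists_homogeneous_family hD Y
  obtain ⟨u₀, hu₀⟩ := (hF 0).nonempty
  -- The type of one point of the graph over `F`, which will turn out to be the type over every
  -- member.
  let b : Set ℕ := {m | M.mem (M.pair u₀ (θ ⟨u₀, hFD u₀ hu₀⟩)) (A m)}
  obtain ⟨⟨m₀, hm₀⟩, hb⟩ := (hAB (M.pair u₀ (θ ⟨u₀, hFD u₀ hu₀⟩))).1 ⟨⟨u₀, hFD u₀ hu₀⟩, rfl⟩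
  have hgraph : ∀ (u : M.internalSubsets D) (y : M.HyperNat),
      (∀ n, HasPattern A b n (M.pair (u : M.Obj (.set .nat)) y)) → y = θ u := by
    intro u y h
    have hA : ∀ m, M.mem (M.pair (u : M.Obj (.set .nat)) y) (A m) ↔ m ∈ b :=
      fun m => h (m + 1) m m.lt_succ_self
    have hAb : {m | M.mem (M.pair (u : M.Obj (.set .nat)) y) (A m)} = b := Set.ext hA
    obtain ⟨x, hx⟩ := (hAB (M.pair (u : M.Obj (.set .nat)) y)).2
      ⟨⟨m₀, (hA m₀).2 hm₀⟩, hAb.symm ▸ hb⟩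
    obtain ⟨h1, h2⟩ := M.pair_inj.1 hx
    rw [h2, Subtype.ext h1]
  have hpattern : ∀ u : M.internalSubsets D, M.mem (u : M.Obj (.set .nat)) F →
      ∀ n, HasPattern A b n (M.pair (u : M.Obj (.set .nat)) (θ u)) := by
    intro u hu
    -- Each finite part of `b` is realised over `u₀`, hence over `u` by homogeneity; saturation
    -- realises the whole of `b`.
    have hex : ∃ y, ∀ n, HasPattern A b n (M.pair (u : M.Obj (.set .nat)) y) := by
      refine exists_forall_of_antitone
        (fun n => (isInternal_hasPattern A b n).fiber (u : M.Obj (.set .nat)))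
        (fun m n y h hp => hp.anti h) fun n => ?_
      classical
      obtain ⟨i, hi⟩ := he (n, (Finset.range n).filter (· ∈ b))
      have hpat : ∀ p, HasPattern A (e i).2 (e i).1 p ↔ HasPattern A b n p := by
        rw [hi]
        exact hasPattern_congr fun m hm => by simp [hm]
      have h0 : M.mem u₀ (Y i) :=
        (hY i u₀).2 ⟨θ ⟨u₀, hFD u₀ hu₀⟩, (hpat _).2 fun m _ => Iff.rfl⟩
      have h1 : M.mem (u : M.Obj (.set .nat)) (Y i) := by
        rcases hhom i with h | h
        · exact h _ hu
        · exact (h _ hu₀ h0).elim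
      obtain ⟨y, hy⟩ := (hY i _).1 h1
      exact ⟨y, (hpat _).1 hy⟩
    obtain ⟨y, hy⟩ := hex
    rwa [← hgraph u y hy]
  choose G hG using fun n => isInternal_hasPattern A b n
  refine ⟨F, G, hF, hFD, fun m n p h hp => (hG m p).2 (((hG n p).1 hp).anti h),
    fun u hu y => ⟨fun h => hgraph u y fun n => (hG n _).1 (h n), ?_⟩⟩
  rintro rfl
  exact fun n => (hG n _).2 (hpattern u hu n)

/-- Saturation for quadruples consisting of two members of `F`, related by internal relations,
and related values under a decreasing sequence of internal relations. -/
theorem exists_pair_of_antitone (F : M.Obj (.set (.set .nat)))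
    (G : ℕ → M.Obj (.set (.prod (.set .nat) .nat)))
    (hG : ∀ m n p, m ≤ n → M.mem p (G n) → M.mem p (G m))
    {R : ℕ → M.Obj (.prod (.set .nat) (.set .nat)) → Prop} (hR : ∀ n, M.IsInternal (R n))
    (hRanti : ∀ m n p, m ≤ n → R n p → R m p)
    {S : ℕ → M.Obj (.prod (.prod .nat .nat) .nat) → Prop} (hS : ∀ n, M.IsInternal (S n))
    (a : ℕ → M.HyperNat)
    (hSanti : ∀ m n y z, m ≤ n → S n (M.pair (M.pair y z) (a n)) →
      S m (M.pair (M.pair y z) (a m)))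
    (h : ∀ n, ∃ u y v z, M.mem u F ∧ M.mem v F ∧ M.mem (M.pair u y) (G n) ∧
      M.mem (M.pair v z) (G n) ∧ R n (M.pair u v) ∧ S n (M.pair (M.pair y z) (a n))) :
    ∃ u y v z, M.mem u F ∧ M.mem v F ∧ ∀ n, M.mem (M.pair u y) (G n) ∧
      M.mem (M.pair v z) (G n) ∧ R n (M.pair u v) ∧ S n (M.pair (M.pair y z) (a n)) := by
  -- Saturation concerns a single object, so the quadruple is coded as a nested pair. Injectivity of
  -- pairing later shows that the components are the same for all `n`.
  have hint : ∀ n, M.IsInternal fun q : M.Obj (.prod (.prod (.set .nat) .nat)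
      (.prod (.set .nat) .nat)) => ∃ u y v z, q = M.pair (M.pair u y) (M.pair v z) ∧
      M.mem u F ∧ M.mem v F ∧ M.mem (M.pair u y) (G n) ∧
      M.mem (M.pair v z) (G n) ∧ R n (M.pair u v) ∧ S n (M.pair (M.pair y z) (a n)) := by
    intro n
    obtain ⟨R', hR'⟩ := hR n
    obtain ⟨S', hS'⟩ := hS n
    obtain ⟨B, hB⟩ := M.comprehension (Γ := [.set (.set .nat), .set (.prod (.set .nat) .nat),
        .set (.prod (.set .nat) (.set .nat)), .set (.prod (.prod .nat .nat) .nat), .nat])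
      (.ex (.set .nat) (.ex .nat (.ex (.set .nat) (.ex .nat
        (.and (.eq v4 (.pair (.pair v3 v2) (.pair v1 v0))) (.and (.mem v3 v5) (.and (.mem v1 v5)
        (.and (.mem (.pair v3 v2) v6) (.and (.mem (.pair v1 v0) v6)
        (.and (.mem (.pair v3 v1) v7) (.mem (.pair (.pair v2 v0) v9) v8)))))))))))
      (Env.cons F (Env.cons (G n) (Env.cons R' (Env.cons S' (Env.cons (a n) Env.nil)))))
    refine ⟨B, fun q => (hB q).trans ?_⟩
    simp only [Formula.Holds, Formula.holds_imp, Formula.holds_iff, Formula.holds_or,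
    Formula.holds_ex, Term.eval, Env.cons_zero, Env.cons_succ]
    simp only [hR', hS']
  obtain ⟨q, hq⟩ := exists_forall_of_antitone hint (by
      rintro m n q hmn ⟨u, y, v, z, e, hu, hv, h1, h2, h3, h4⟩
      exact ⟨u, y, v, z, e, hu, hv, hG m n _ hmn h1, hG m n _ hmn h2, hRanti m n _ hmn h3,
        hSanti m n y z hmn h4⟩)
    (fun n => by
      obtain ⟨u, y, v, z, h⟩ := h n
      exact ⟨_, u, y, v, z, rfl, h⟩)
  obtain ⟨u, y, v, z, e, hu, hv, -⟩ := hq 0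
  refine ⟨u, y, v, z, hu, hv, fun n => ?_⟩
  obtain ⟨u', y', v', z', e', -, -, h⟩ := hq n
  obtain ⟨e1, e2⟩ := M.pair_inj.1 (e.symm.trans e')
  obtain ⟨rfl, rfl⟩ := M.pair_inj.1 e1
  obtain ⟨rfl, rfl⟩ := M.pair_inj.1 e2
  exact h

end Universe

end Nonstandard

/-! ### The contradiction -/

/-- For an infinite hyperfinite set `D` of hypernatural numbers and an additive countably cofinal
cut `U`, the finite difference relation restricted to the internal subsets of `D` is not
CD-reducible to the monadic relation of `U` on the hypernatural numbers. -/
theorem mainTheorem9 (M : Nonstandard.Universe.{u})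
    (D : M.Obj (.set .nat)) (hD : M.Hyperfinite D) (hDinf : (M.elems D).Infinite)
    (U : Set M.HyperNat) (hcut : M.IsCut U) (hadd : M.IsAdditive U)
    (hcof : M.IsCountablyCofinal U) :
    ¬ M.CDReducible (M.internalSubsets D) M.FD Set.univ (M.monadic U) := by
  open Nonstandard Nonstandard.Universe in
  rintro ⟨θ', hθ', hred'⟩
  let θ : M.internalSubsets D → M.HyperNat := fun x => (θ' x : M.HyperNat)
  obtain ⟨a, ha, rfl⟩ := hcof
  have hmon : ∀ y z, M.monadic (⋃ n, {x | M.Lt x (a n)}) y z ↔ ∃ n, M.AbsLt y z (a n) := by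
    intro y z
    simp only [absLt_iff, monadic, Set.mem_iUnion, Set.mem_ofPred_eq]
    exact ⟨fun ⟨d, ⟨n, h1⟩, h2⟩ => ⟨n, d, h2, h1⟩, fun ⟨n, d, h2, h1⟩ => ⟨d, ⟨n, h1⟩, h2⟩⟩
  have hred : ∀ x x' : M.internalSubsets D, (∃ n, M.CloseLE n x x') ↔
      ∃ n, M.AbsLt (θ x) (θ x') (a n) := fun x x' => by
    rw [← fd_iff_exists_closeLE, hred' x x']
    exact hmon _ _
  have hmono : ∀ m n y z, m ≤ n → M.AbsLt y z (a m) → M.AbsLt y z (a n) := by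
    intro m n y z h hyz
    rcases h.eq_or_lt with rfl | h
    · exact hyz
    · exact hyz.trans_lt (ha m n h)
  obtain ⟨F, G, hF, hFD, hG, hgraph⟩ := exists_family_graph hDinf θ hθ'
  -- Otherwise saturation yields `u`, `v` differing in at most 2 points with `θ u`, `θ v` not less
  -- than `a n` apart for any `n`, against the forward direction of the reduction.
  obtain ⟨n, hn⟩ : ∃ n, ∀ u, M.mem u F → ∀ v, M.mem v F → ∀ y z, M.CloseLE 2 u v →
      M.mem (M.pair u y) (G n) → M.mem (M.pair v z) (G n) → M.AbsLt y z (a n) := by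
    by_contra! hcon
    obtain ⟨u, y, v, z, hu, hv, h⟩ := exists_pair_of_antitone F G hG
      (R := fun _ p => M.mem p (M.star (closeLE 2))) (fun _ => isInternal_mem _)
      (fun _ _ _ _ h => h) (S := fun _ p => ¬ M.mem p (M.star absLt))
      (fun _ => (isInternal_mem _).not) a (fun m n y z h => mt (hmono m n y z h))
      (fun n => by
        obtain ⟨u, hu, v, hv, y, z, h1, h2, h3, h4⟩ := hcon n
        exact ⟨u, y, v, z, hu, hv, h2, h3, h1, h4⟩)
    have hy := (hgraph ⟨u, hFD u hu⟩ hu y).1 fun n => (h n).1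
    have hz := (hgraph ⟨v, hFD v hv⟩ hv z).1 fun n => (h n).2.1
    obtain ⟨n, hn⟩ := (hred ⟨u, hFD u hu⟩ ⟨v, hFD v hv⟩).1 ⟨2, (h 0).2.2.1⟩
    rw [← hy, ← hz] at hn
    exact (h n).2.2.2 hn
  -- The same argument for the backward direction, with the bound `a n` now fixed. Requiring `n ≤ K`
  -- makes `G K` a subrelation of `G n`, so the exchange bound holds for `G K` too.
  obtain ⟨K, hnK, hK⟩ : ∃ K, n ≤ K ∧ ∀ u, M.mem u F → ∀ v, M.mem v F → ∀ y z,
      M.mem (M.pair u y) (G K) → M.mem (M.pair v z) (G K) → M.AbsLt y z (a n) →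
      M.CloseLE K u v := by
    by_contra! hcon
    obtain ⟨u, y, v, z, hu, hv, h⟩ := exists_pair_of_antitone F G hG
      (R := fun K p => ¬ M.mem p (M.star (closeLE K))) (fun _ => (isInternal_mem _).not)
      (fun i j p h => by
        obtain ⟨u, v, rfl⟩ := M.exists_eq_pair p
        exact mt (CloseLE.mono h))
      (S := fun _ p => M.mem p (M.star absLt))
      (fun _ => isInternal_mem _) (fun _ => a n) (fun _ _ _ _ _ h => h)
      (fun i => by
        obtain ⟨u, hu, v, hv, y, z, h1, h2, h3, h4⟩ := hcon (max n i) (le_max_left _ _)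
        exact ⟨u, y, v, z, hu, hv, hG _ _ _ (le_max_right _ _) h1,
          hG _ _ _ (le_max_right _ _) h2, mt (CloseLE.mono (le_max_right _ _)) h4, h3⟩)
    have hy := (hgraph ⟨u, hFD u hu⟩ hu y).1 fun n => (h n).1
    have hz := (hgraph ⟨v, hFD v hv⟩ hv z).1 fun n => (h n).2.1
    obtain ⟨k, hk⟩ := (hred ⟨u, hFD u hu⟩ ⟨v, hFD v hv⟩).2 ⟨n, by
      rw [← hy, ← hz]
      exact (h 0).2.2.2⟩
    exact (h k).2.2.1 hk
  -- Totality of `G K` over `F` holds because it contains the graph of `θ` there.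
  obtain ⟨u, hu, v, hv, y, z, hy, hz, hyz, hfar⟩ := (hF K).exists_far (G K) (a n)
    (fun u hu => ⟨θ ⟨u, hFD u hu⟩, (hgraph ⟨u, hFD u hu⟩ hu _).2 rfl K⟩)
    (fun u hu v hv y z huv hy hz => hn u hu v hv y z huv (hG n K _ hnK hy) (hG n K _ hnK hz))
  exact hfar (hK u hu v hv y z hy hz hyz)
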